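/- Let $\mathcal L$ be a (one-sorted) language containing the language $\{+,\cdot,\mathcal O\}$ of valued fields, and let $\mathcal T$ be a (not necessarily complete) $\mathcal L$-theory all of whose models are non-trivially valued fields of characteristic $0$. For a model $K$, write the valuation multiplicatively as $|\cdot|\colon K\to\Gamma_K=\Gamma_K^\times\cup\{0\}$. For $\lambda\le 1$ in $\Gamma_K^\times$ let $\mathrm{RV}_\lambda=\{0\}\cup K^\times/(1+\{x:|x|<\lambda\})$, with the quotient map $\operatorname{rv}_\lambda\colon K\to\mathrm{RV}_\lambda$, $\operatorname{rv}_\lambda(0)=0$. Definability of sets in, or with parameters from, such quotients is understood in the sense of imaginary sorts, and unions over $\lambda$ of the sets $\mathrm{RV}_\lambda^{p}$ are disjoint unions. A set $X\subset K$ is *$\lambda$-prepared* by a finite non-empty set $C\subset K$ if whether $x\in K$ lies in $X$ depends only on the tuple $(\operatorname{rv}_\lambda(x-c))_{c\in C}$. A ball $B\subset K$ is *$\lambda$-next* to $c\in K$ if $B=\{x\in K:\operatorname{rv}_\lambda(x-c)=\xi\}$ for some $\xi\ne0$ in $\mathrm{RV}_\lambda$; it is *$\lambda$-next* to a finite non-empty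 set $C$ if $B=\bigcap_{c\in C}B_c$, where each $B_c$ is a ball $\lambda$-next to $c$. Let $\ell\ge 0$ be an integer or $\omega$. The theory $\mathcal T$ is *$\ell$-h$^{\mathrm{mix}}$-minimal* if for each model $K$ of $\mathcal T$, each integer $n\ge1$, each $\lambda\le1$ in $\Gamma_K^\times$, each $A\subset K$, each finite $A'\subset\mathrm{RV}_\lambda$ with $\#A'\le\ell$ and each $(A\cup\mathrm{RV}_{|n|}\cup A')$-definable set $X\subset K$, there are an integer $m\ge1$ and a finite non-empty $A$-definable set $C\subset K$ such that $X$ is $|m|\lambda$-prepared by $C$. **Proposition (preparing families).** Assume that $\mathcal T$ is $\ell$-h$^{\mathrm{mix}}$-minimal. Let $K$ be a model of $\mathcal T$, let $A\subset K$, let $k\ge0$, $n\ge1$ and $0\le p\le\ell$ be integers (one may take $p=\ell$ if $\ell$ is an integer), and let $$W\subset K\times\mathrm{RV}_{|n|}^k\times\bigcup_{\lambda\le1}\mathrm{RV}_\lambda^{p}$$ be $A$-definable. Then there exist a finite non-empty $A$-definable set $C\subset K$ and an integer $m\ge1$ such that for every $\lambda\le1$ in $\Gamma_K^\times$ and every ball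 $B$ that is $|m|\lambda$-next to $C$, the set $$W_{x,\lambda}=\{(\xi,\xi')\in\mathrm{RV}_{|n|}^k\times\mathrm{RV}_\lambda^{p}\mid(x,\xi,\xi')\in W\}$$ is independent of $x$ as $x$ runs over $B$. -/

import Mathlib

open scoped FirstOrder

universe u v w

noncomputable section

namespace HMix

open FirstOrder FirstOrder.Language

/-! ### The language of valued fields and valued fields as structures -/

/-- Function symbols of the language of valued fields: addition and multiplication. -/
inductive ValFunctions : ℕ → Type
  | add : ValFunctions 2
  | mul : ValFunctions 2

/-- Relation symbols of the language of valued fields: a unary predicate for the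
valuation ring. -/
inductive ValRelations : ℕ → Type
  | integer : ValRelations 1

/-- The language `{+, ·, 𝒪}` of valued fields. -/
def Lval : FirstOrder.Language.{0, 0} := ⟨ValFunctions, ValRelations⟩

/-- The `L`-structure on `K` expands the (non-trivially) valued field `(K, +, ·, O)`, where `ι`
is the inclusion of the language of valued fields in `L`. -/
structure IsValuedFieldStructure {L : FirstOrder.Language.{u, v}} (ι : Lval →ᴸ L)
    (K : Type w) [Field K] [L.Structure K] (O : ValuationSubring K) : Prop where
  add : ∀ x : Fin 2 → K, Structure.funMap (ι.onFunction ValFunctions.add) x = x 0 + x 1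
  mul : ∀ x : Fin 2 → K, Structure.funMap (ι.onFunction ValFunctions.mul) x = x 0 * x 1
  integer : ∀ x : Fin 1 → K,
    Structure.RelMap (ι.onRelation ValRelations.integer) x ↔ x 0 ∈ O
  nontrivial : O ≠ ⊤

/-- Every model of `T` is a non-trivially valued field of characteristic zero. -/
def IsValuedFieldTheory {L : FirstOrder.Language.{u, v}} (ι : Lval →ᴸ L) (T : L.Theory) : Prop :=
  ∀ (K : Type (max u v w)) [Nonempty K] [L.Structure K] [K ⊨ T],
    ∃ (_ : Field K) (O : ValuationSubring K), CharZero K ∧ IsValuedFieldStructure ι K O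

/-! ### Leading terms, balls, preparation -/

section ValuedField

variable {K : Type w} [Field K] (O : ValuationSubring K)

/-- The elements `r ≤ 1` of the value group `Γ_K^×` (written multiplicatively). -/
def Radius : Type w := {r : O.ValueGroup // r ≠ 0 ∧ r ≤ 1}

instance : Mul (Radius O) :=
  ⟨fun r s => ⟨r.1 * s.1, mul_ne_zero r.2.1 s.2.1, mul_le_one' r.2.2 s.2.2⟩⟩

/-- The element `|n|` of the value group, for a positive integer `n`. -/
def absNat [CharZero K] (n : ℕ+) : Radius O :=
  ⟨O.valuation ((n : ℕ) : K),
    (Valuation.ne_zero_iff _).2 (Nat.cast_ne_zero.2 n.ne_zero),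
    (O.valuation_le_one_iff _).2 (natCast_mem O _)⟩

/-- The subgroup `1 + I` of `Kˣ`, where `I` is the open ball `{x | |x| < r}`. -/
def oneAdd (r : Radius O) : Subgroup Kˣ where
  carrier := {a | O.valuation ((a : K) - 1) < r.1}
  one_mem' := by simpa [zero_lt_iff] using r.2.1
  mul_mem' := by
    intro a b ha hb
    have ha1 : O.valuation (a : K) = 1 :=
      (Valuation.map_eq_of_sub_lt O.valuation (x := 1) (y := (a : K))
        (by rw [map_one]; exact lt_of_lt_of_le ha r.2.2)).trans (map_one _)
    have h : ((a * b : Kˣ) : K) - 1 = a * (b - 1) + (a - 1) := by push_cast; ring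
    change O.valuation _ < _
    rw [h]
    refine Valuation.map_add_lt _ ?_ ha
    rw [map_mul, ha1, one_mul]
    exact hb
  inv_mem' := by
    intro a ha
    have ha1 : O.valuation (a : K) = 1 :=
      (Valuation.map_eq_of_sub_lt O.valuation (x := 1) (y := (a : K))
        (by rw [map_one]; exact lt_of_lt_of_le ha r.2.2)).trans (map_one _)
    have h : ((a⁻¹ : Kˣ) : K) - 1 = -((a : K)⁻¹ * (a - 1)) := by
      have := a.ne_zero
      push_cast
      field_simp
      ring
    change O.valuation _ < _
    rw [h, Valuation.map_neg, map_mul, map_inv₀, ha1, inv_one, one_mul]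
    exact ha

/-- `RV_r`: the disjoint union of `{0}` with the quotient group `Kˣ / (1 + I)`. -/
def RV (r : Radius O) : Type w := WithZero (Kˣ ⧸ oneAdd O r)

instance (r : Radius O) : Zero (RV O r) := inferInstanceAs (Zero (WithZero _))

open Classical in
/-- The leading term map `rv_r : K → RV_r`, sending `0` to `0`. -/
def rv (r : Radius O) (x : K) : RV O r :=
  if h : x = 0 then 0 else
    ((QuotientGroup.mk (Units.mk0 x h) : Kˣ ⧸ oneAdd O r) : WithZero (Kˣ ⧸ oneAdd O r))

theorem rv_zero (r : Radius O) : rv O r 0 = 0 := by simp [rv]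

theorem rv_of_ne_zero (r : Radius O) {x : K} (h : x ≠ 0) : rv O r x =
    ((QuotientGroup.mk (Units.mk0 x h) : Kˣ ⧸ oneAdd O r) : WithZero (Kˣ ⧸ oneAdd O r)) :=
  dif_neg h

theorem rv_ne_zero (r : Radius O) {x : K} (h : x ≠ 0) : rv O r x ≠ 0 := by
  rw [rv_of_ne_zero O r h]
  exact WithZero.coe_ne_zero

theorem rv_surjective (r : Radius O) : Function.Surjective (rv O r) := by
  intro e
  rcases e with _ | a
  · exact ⟨0, rv_zero O r⟩
  · obtain ⟨a, rfl⟩ := QuotientGroup.mk_surjective a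
    refine ⟨a, (rv_of_ne_zero O r a.ne_zero).trans ?_⟩
    rw [Units.mk0_val]
    rfl

theorem rv_eq_rv_iff (r : Radius O) (x y : K) :
    rv O r x = rv O r y ↔ x = y ∨ O.valuation (y - x) < r.1 * O.valuation x := by
  by_cases hx : x = 0
  · subst hx
    by_cases hy : y = 0
    · simp [hy]
    · simp only [rv_zero, map_zero, mul_zero, not_lt_zero, or_false]
      exact ⟨fun h => (rv_ne_zero O r hy h.symm).elim, fun h => (hy h.symm).elim⟩
  · by_cases hy : y = 0
    · subst hy
      simp only [rv_zero, hx, false_or, zero_sub, Valuation.map_neg]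
      exact ⟨fun h => (rv_ne_zero O r hx h).elim,
        fun h => absurd h (not_lt.2 (mul_le_of_le_one_left' r.2.2))⟩
    · have h1 : rv O r x = rv O r y ↔
          (QuotientGroup.mk (Units.mk0 x hx) : Kˣ ⧸ oneAdd O r)
            = QuotientGroup.mk (Units.mk0 y hy) := by
        rw [rv_of_ne_zero O r hx, rv_of_ne_zero O r hy]
        exact WithZero.coe_inj
      have hv : 0 < O.valuation x := zero_lt_iff.2 ((Valuation.ne_zero_iff _).2 hx)
      have h2 : y - x = (x⁻¹ * y - 1) * x := by field_simp
      have h3 : O.valuation (y - x) < r.1 * O.valuation x ↔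
          O.valuation (x⁻¹ * y - 1) < r.1 := by
        rw [h2, map_mul]
        exact mul_lt_mul_iff_left₀ hv
      rw [h1, QuotientGroup.eq, h3]
      change O.valuation (((Units.mk0 x hx)⁻¹ * Units.mk0 y hy : Kˣ) - 1 : K) < r.1 ↔ _
      simp only [Units.val_mul, Units.val_inv_eq_inv_val, Units.val_mk0]
      refine ⟨Or.inr, ?_⟩
      rintro (rfl | h)
      · simpa [hx, zero_lt_iff] using r.2.1
      · exact h

/-- Open and closed balls (with radius in `Γ_K^×`). -/
def IsBall (B : Set K) : Prop :=
  ∃ (a : K) (s : O.ValueGroup), s ≠ 0 ∧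
    (B = {x | O.valuation (x - a) < s} ∨ B = {x | O.valuation (x - a) ≤ s})

/-- `X` is `r`-prepared by the finite non-empty set `C`: whether `x` lies in `X` depends only on
the tuple `(rv_r (x - c))_{c ∈ C}`. -/
def IsPrepared (r : Radius O) (X C : Set K) : Prop :=
  C.Finite ∧ C.Nonempty ∧
    ∀ x y : K, (∀ c ∈ C, rv O r (x - c) = rv O r (y - c)) → (x ∈ X ↔ y ∈ X)

/-- The ball `B` is `r`-next to the element `c`. -/
def IsNextToPoint (r : Radius O) (B : Set K) (c : K) : Prop :=
  IsBall O B ∧ ∃ ξ : RV O r, ξ ≠ 0 ∧ B = {x | rv O r (x - c) = ξ}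

/-- The ball `B` is `r`-next to the finite non-empty set `C`. -/
def IsNextTo (r : Radius O) (B C : Set K) : Prop :=
  IsBall O B ∧ ∃ D : K → Set K, (∀ c ∈ C, IsNextToPoint O r (D c) c) ∧ B = ⋂ c ∈ C, D c

/-- The disjoint union `RV_• = ⋃_{r ≤ 1} RV_r`, an imaginary sort. -/
abbrev RVdot : Type w := Σ r : Radius O, RV O r

/-- The disjoint union `⋃_{r ≤ 1} RV_r ^ p`, an imaginary sort. -/
abbrev RVTuples (p : ℕ) : Type w := Σ r : Radius O, (Fin p → RV O r)

/-- The pair `(l, z)` of elements of `K` represents the element `e` of `RV_•`, that is,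
`e` is the class of `z` in `RV_r` for `r = |l|`. -/
def Represents (l z : K) (e : RVdot O) : Prop :=
  O.valuation l = e.1.1 ∧ rv O e.1 z = e.2

/-! ### Definability with imaginary sorts -/

variable (L : FirstOrder.Language.{u, v}) [L.Structure K]

/-- `X ⊆ K` is `(A ∪ E)`-definable, for `A ⊆ K` and a set `E` of imaginaries from `RV_•`: for
some finite tuple `e` from `E`, the set `X` is given by an `L`-formula with parameters from `A`
and from an arbitrary tuple of representatives of `e`. -/
def DefinableOver (A : Set K) (E : Set (RVdot O)) (X : Set K) : Prop :=
  ∃ (s : ℕ) (e : Fin s → RVdot O), (∀ i, e i ∈ E) ∧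
    ∃ D : Set (Unit ⊕ (Fin s ⊕ Fin s) → K), A.Definable L D ∧
      ∀ l z : Fin s → K, (∀ i, Represents O (l i) (z i) (e i)) →
        X = {x | Sum.elim (fun _ => x) (Sum.elim l z) ∈ D}

/-- A subset `W` of `K × RV_{|n|}^k × ⋃_{r ≤ 1} RV_r^p` is `A`-definable: its preimage in a
Cartesian power of `K`, consisting of the tuples `(x, y, l, z)` with
`(x, (rv_{|n|} y_i)_i, (rv_{|l|} z_j)_j) ∈ W`, is `A`-definable. -/
def DefinableFamily [CharZero K] (A : Set K) {k p : ℕ} {n : ℕ+}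
    (W : Set (K × (Fin k → RV O (absNat O n)) × RVTuples O p)) : Prop :=
  A.Definable L {t : Unit ⊕ (Fin k ⊕ (Unit ⊕ Fin p)) → K |
    ∃ r : Radius O, O.valuation (t (Sum.inr (Sum.inr (Sum.inl ())))) = r.1 ∧
      (t (Sum.inl ()),
        (fun i => rv O (absNat O n) (t (Sum.inr (Sum.inl i)))),
        (⟨r, fun j => rv O r (t (Sum.inr (Sum.inr (Sum.inr j))))⟩ : RVTuples O p)) ∈ W}

/-- The fibre `W_{x, r} ⊆ RV_{|n|}^k × RV_r^p`. -/
def fiber [CharZero K] {k p : ℕ} {n : ℕ+}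
    (W : Set (K × (Fin k → RV O (absNat O n)) × RVTuples O p)) (x : K) (r : Radius O) :
    Set ((Fin k → RV O (absNat O n)) × (Fin p → RV O r)) :=
  {q | (x, q.1, (⟨r, q.2⟩ : RVTuples O p)) ∈ W}

end ValuedField

/-- `ℓ`-h^mix-minimality of the theory `T`, for `ℓ` a natural number or `ω` (which is `⊤`). -/
def IsHMixMinimal {L : FirstOrder.Language.{u, v}} (ι : Lval →ᴸ L) (T : L.Theory) (ℓ : ℕ∞) : Prop :=
  ∀ (K : Type (max u v w)) [Field K] [CharZero K] [L.Structure K] [K ⊨ T]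
    (O : ValuationSubring K), IsValuedFieldStructure ι K O →
    ∀ (n : ℕ+) (r : Radius O) (A : Set K) (A' : Set (RV O r)), A'.Finite → A'.encard ≤ ℓ →
      ∀ X : Set K,
        DefinableOver O L A (Set.range (Sigma.mk (absNat O n)) ∪ Sigma.mk r '' A') X →
        ∃ (m : ℕ+) (C : Set K), A.Definable₁ L C ∧ IsPrepared O (absNat O m * r) X C

end HMix

end

/-! This is a compactness argument in which an ultrapower replaces saturation. Two points of a ball
next to `C` have the same leading terms around every `c ∈ C`, so it suffices to treat such pairs,
with representatives in `K` of all leading terms (`exists_prepared`). If every pair (finite `C`,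
`m`) fails, each failure gives parameters `t` and points `x`, `y`. Their classes along an
ultrafilter refining the order on these pairs live in an ultrapower, again a model of the theory.
There minimality prepares the single fibre at the class of `t` by some `C'`. The formula for `C'`,
read in `K`, defines a finite set that almost every failure had to take into account, so by Łoś the
classes of `x` and `y` contradict the preparation. -/

namespace HMix

open FirstOrder FirstOrder.Language Filter

/-! ### Leading terms via representatives -/

section Lead

variable {K : Type*} [Field K] (O : ValuationSubring K)

/-- `a` and `b` have the same leading term in `RV_r` for `r = |s|`. -/
def SameLead (s a b : K) : Prop :=
  a = b ∨ O.valuation (b - a) < O.valuation (s * a)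

variable {O}

theorem SameLead.mono {s s' a b : K} (h : SameLead O s a b)
    (hs : O.valuation s ≤ O.valuation s') : SameLead O s' a b := by
  refine h.imp_right fun h => h.trans_le ?_
  rw [map_mul, map_mul]
  exact mul_le_mul_left hs _

theorem rv_eq_rv_iff_sameLead {r : Radius O} {s : K} (hs : O.valuation s = r.1) (a b : K) :
    rv O r a = rv O r b ↔ SameLead O s a b := by
  rw [rv_eq_rv_iff, SameLead, map_mul, hs]

theorem valuation_natCast_le_of_dvd {m n : ℕ} (h : m ∣ n) :
    O.valuation (n : K) ≤ O.valuation (m : K) := by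
  obtain ⟨c, rfl⟩ := h
  rw [Nat.cast_mul, map_mul]
  exact mul_le_of_le_one_right' ((O.valuation_le_one_iff _).2 (natCast_mem O c))

end Lead

/-! ### Valuation and leading terms in ultrapowers -/

section Ultrapower

variable {K K' I : Type*} [Field K] [Field K'] {O : ValuationSubring K}
  {O' : ValuationSubring K'} {U : Ultrafilter I} {π : (I → K) →+* K'}

/-- The comparison `|a| ≤ |b|` says that `a = c * b` for some integral `c`, and such a `c` can be
chosen coordinatewise. -/
theorem valuation_le_iff_eventually (hsurj : Function.Surjective π)
    (heq : ∀ a b, π a = π b ↔ ∀ᶠ i in U, a i = b i)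
    (hmem : ∀ a, π a ∈ O' ↔ ∀ᶠ i in U, a i ∈ O) (a b : I → K) :
    O'.valuation (π a) ≤ O'.valuation (π b) ↔
      ∀ᶠ i in U, O.valuation (a i) ≤ O.valuation (b i) := by
  rw [ValuationSubring.valuation_le_iff]
  constructor
  · rintro ⟨⟨c, hc⟩, h⟩
    obtain ⟨c, rfl⟩ := hsurj c
    rw [← map_mul, heq] at h
    filter_upwards [(hmem c).1 hc, h] with i hi hi'
    rw [ValuationSubring.valuation_le_iff]
    exact ⟨⟨c i, hi⟩, hi'⟩
  · intro h
    have h' : ∀ i, ∃ c : K, O.valuation (a i) ≤ O.valuation (b i) → c ∈ O ∧ c * b i = a i := by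
      intro i
      by_cases hi : O.valuation (a i) ≤ O.valuation (b i)
      · obtain ⟨c, hc⟩ := (ValuationSubring.valuation_le_iff _ _ _).1 hi
        exact ⟨c, fun _ => ⟨c.2, hc⟩⟩
      · exact ⟨0, fun h => (hi h).elim⟩
    choose c hc using h'
    refine ⟨⟨π c, (hmem c).2 (h.mono fun i hi => (hc i hi).1)⟩, ?_⟩
    rw [← map_mul, heq]
    exact h.mono fun i hi => (hc i hi).2

theorem sameLead_iff_eventually (hsurj : Function.Surjective π)
    (heq : ∀ a b, π a = π b ↔ ∀ᶠ i in U, a i = b i)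
    (hmem : ∀ a, π a ∈ O' ↔ ∀ᶠ i in U, a i ∈ O) (s a b : I → K) :
    SameLead O' (π s) (π a) (π b) ↔ ∀ᶠ i in U, SameLead O (s i) (a i) (b i) := by
  simp only [SameLead, Ultrafilter.eventually_or, heq]
  refine or_congr Iff.rfl ?_
  rw [← not_le, ← map_sub, ← map_mul, valuation_le_iff_eventually hsurj heq hmem,
    ← Ultrafilter.eventually_not]
  simp only [not_le, Pi.mul_apply, Pi.sub_apply]

/-- The quotient map onto an ultrapower of a valued field, as a ring homomorphism. -/
theorem exists_ringHom_ultrapower {L : FirstOrder.Language.{u, v}} (ι : Lval →ᴸ L)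
    {K I : Type*} [Field K] [L.Structure K] (O : ValuationSubring K)
    (hO : IsValuedFieldStructure ι K O) (U : Ultrafilter I)
    [Field ((U : Filter I).Product fun _ => K)]
    (O' : ValuationSubring ((U : Filter I).Product fun _ => K))
    (hO' : IsValuedFieldStructure ι ((U : Filter I).Product fun _ => K) O') :
    ∃ π : (I → K) →+* (U : Filter I).Product fun _ => K,
      (∀ a, π a = (a : (U : Filter I).Product fun _ => K)) ∧ Function.Surjective π ∧
      (∀ a b, π a = π b ↔ ∀ᶠ i in U, a i = b i) ∧
      ∀ a, π a ∈ O' ↔ ∀ᶠ i in U, a i ∈ O := by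
  let q : (I → K) → (U : Filter I).Product fun _ => K := fun a => a
  have hq : ∀ a b, q a = q b ↔ ∀ᶠ i in U, a i = b i := fun a b => Quotient.eq''
  have hadd : ∀ a b, q (a + b) = q a + q b := by
    intro a b
    have h : Structure.funMap (ι.onFunction ValFunctions.add) (fun i : Fin 2 => q (![a, b] i)) =
        q fun j => Structure.funMap (ι.onFunction ValFunctions.add) fun i : Fin 2 => ![a, b] i j :=
      Ultraproduct.funMap_cast _ _
    simp only [hO.add] at h
    exact h.symm.trans (hO'.add _)
  have hmul : ∀ a b, q (a * b) = q a * q b := by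
    intro a b
    have h : Structure.funMap (ι.onFunction ValFunctions.mul) (fun i : Fin 2 => q (![a, b] i)) =
        q fun j => Structure.funMap (ι.onFunction ValFunctions.mul) fun i : Fin 2 => ![a, b] i j :=
      Ultraproduct.funMap_cast _ _
    simp only [hO.mul] at h
    exact h.symm.trans (hO'.mul _)
  -- The field structure on the ultrapower is only known to match the symbols `+`, `·`; hence 0 and
  -- 1 are recovered as idempotents.
  have hzero : q 0 = 0 := by
    have h := hadd 0 0
    rwa [add_zero, left_eq_add] at h
  have hone : q 1 = 1 := by
    have h := hmul 1 1
    rw [mul_one, left_eq_mul₀] at h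
    · exact h
    · rw [← hzero, Ne, hq]
      simp [U.neBot.ne]
  refine ⟨{ toFun := q
            map_one' := hone
            map_mul' := hmul
            map_zero' := hzero
            map_add' := hadd }, fun _ => rfl, Quotient.mk''_surjective, hq, fun a => ?_⟩
  have h : Structure.RelMap (ι.onRelation ValRelations.integer) (fun _ : Fin 1 => q a) ↔
      ∀ᶠ i in U, Structure.RelMap (ι.onRelation ValRelations.integer) (fun _ : Fin 1 => a i) :=
    relMap_quotient_mk' (s := (U : Filter I).productSetoid fun _ => K) _ _
  rw [hO'.integer] at h
  simp only [hO.integer] at h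
  exact h

end Ultrapower

/-! ### Definability of fibres over leading terms -/

section Definability

variable {L : FirstOrder.Language.{u, v}}

theorem definableOver_of_fintype {K : Type*} [Field K] (O : ValuationSubring K) [L.Structure K]
    {A : Set K} {E : Set (RVdot O)} {X : Set K} {σ : Type} [Fintype σ]
    (e : σ → RVdot O) (he : ∀ i, e i ∈ E) {D : Set (Unit ⊕ σ → K)} (hD : A.Definable L D)
    (hX : ∀ l z : σ → K, (∀ i, Represents O (l i) (z i) (e i)) →
      X = {x | Sum.elim (fun _ => x) z ∈ D}) :
    DefinableOver O L A E X := by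
  let f := Fintype.equivFin σ
  refine ⟨Fintype.card σ, e ∘ f.symm, fun i => he _, _,
    hD.preimage_comp (Sum.map id (Sum.inr ∘ f)), fun l z h => ?_⟩
  rw [hX (l ∘ f) (z ∘ f) fun i => by simpa using h (f i)]
  ext x
  simp only [Set.mem_ofPred_eq, Set.mem_preimage]
  refine iff_of_eq (congrArg (· ∈ D) ?_)
  funext j
  rcases j with j | j <;> rfl

end Definability

/-- The variables `(x, y, l, z)` of a representation of a family in
`K × RV_{|n|}^k × ⋃_r RV_r^p`. -/
abbrev FamilyIndex (k p : ℕ) : Type := Fin k ⊕ (Unit ⊕ Fin p)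

/-- Membership in the preimage of a family depends only on the leading terms. -/
def RespectsLead {K : Type*} [Field K] (O : ValuationSubring K) {k p : ℕ} (n : ℕ+)
    (S : Set (Unit ⊕ FamilyIndex k p → K)) : Prop :=
  ∀ (x : K) (t t' : FamilyIndex k p → K),
    (∀ i, SameLead O ((n : ℕ) : K) (t (.inl i)) (t' (.inl i))) →
    O.valuation (t (.inr (.inl ()))) = O.valuation (t' (.inr (.inl ()))) →
    (∀ j, SameLead O (t (.inr (.inl ()))) (t (.inr (.inr j))) (t' (.inr (.inr j)))) →
    (Sum.elim (fun _ => x) t ∈ S ↔ Sum.elim (fun _ => x) t' ∈ S)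

theorem respectsLead_preimage {K : Type*} [Field K] [CharZero K] (O : ValuationSubring K)
    {k p : ℕ} {n : ℕ+} (W : Set (K × (Fin k → RV O (absNat O n)) × RVTuples O p)) :
    RespectsLead O n {t : Unit ⊕ FamilyIndex k p → K |
      ∃ r : Radius O, O.valuation (t (Sum.inr (Sum.inr (Sum.inl ())))) = r.1 ∧
        (t (Sum.inl ()),
          (fun i => rv O (absNat O n) (t (Sum.inr (Sum.inl i)))),
          (⟨r, fun j => rv O r (t (Sum.inr (Sum.inr (Sum.inr j))))⟩ : RVTuples O p)) ∈ W} := by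
  intro x t t' hy hl hz
  simp only [Set.mem_ofPred_eq, Sum.elim_inl, Sum.elim_inr]
  refine exists_congr fun r => ?_
  rw [← hl]
  refine and_congr_right fun hr => ?_
  have h1 : (fun i => rv O (absNat O n) (t (.inl i))) =
      fun i => rv O (absNat O n) (t' (.inl i)) :=
    funext fun i => (rv_eq_rv_iff_sameLead rfl _ _).2 (hy i)
  have h2 : (fun j => rv O r (t (.inr (.inr j)))) = fun j => rv O r (t' (.inr (.inr j))) :=
    funext fun j => (rv_eq_rv_iff_sameLead hr _ _).2 (hz j)
  rw [h1, h2]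

/-- Only the `p` leading terms in `RV_r` count towards `ℓ`. The parameter giving the radius enters
through its class in `RV_{|n|}`, which already determines its absolute value. -/
theorem definableOver_of_respectsLead {L : FirstOrder.Language.{u, v}} {K : Type*} [Field K]
    [CharZero K] (O : ValuationSubring K) [L.Structure K] {A : Set K} {k p : ℕ} {n : ℕ+}
    {S : Set (Unit ⊕ FamilyIndex k p → K)} (hS : A.Definable L S) (hlead : RespectsLead O n S)
    (t : FamilyIndex k p → K) (r : Radius O) (hr : O.valuation (t (.inr (.inl ()))) = r.1) :
    DefinableOver O L A (Set.range (Sigma.mk (absNat O n)) ∪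
      Sigma.mk r '' Set.range fun j => rv O r (t (.inr (.inr j))))
      {x | Sum.elim (fun _ => x) t ∈ S} := by
  refine definableOver_of_fintype O (fun i : FamilyIndex k p => match i with
    | .inl i => ⟨absNat O n, rv O (absNat O n) (t (.inl i))⟩
    | .inr (.inl ()) => ⟨absNat O n, rv O (absNat O n) (t (.inr (.inl ())))⟩
    | .inr (.inr j) => ⟨r, rv O r (t (.inr (.inr j)))⟩) ?_ hS ?_
  · rintro (i | ⟨⟩ | j)
    · exact Or.inl ⟨_, rfl⟩
    · exact Or.inl ⟨_, rfl⟩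
    · exact Or.inr ⟨_, ⟨j, rfl⟩, rfl⟩
  · intro l z h
    ext x
    refine hlead x t z (fun i => ?_) ?_ fun j => ?_
    · exact (rv_eq_rv_iff_sameLead rfl _ _).1 (h (.inl i)).2.symm
    · rcases (rv_eq_rv_iff _ _ _ _).1 (h (.inr (.inl ()))).2.symm with h' | h'
      · rw [h']
      · exact (Valuation.map_eq_of_sub_lt _
          (h'.trans_le (mul_le_of_le_one_left' (absNat O n).2.2))).symm
    · exact (rv_eq_rv_iff_sameLead hr _ _).1 (h (.inr (.inr j))).2.symm

/-! ### The compactness argument -/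

theorem exists_prepared {L : FirstOrder.Language.{u, v}} (ι : Lval →ᴸ L) (T : L.Theory)
    (hT : IsValuedFieldTheory.{u, v, w} ι T) (ℓ : ℕ∞) (hmin : IsHMixMinimal.{u, v, w} ι T ℓ)
    (K : Type (max u v w)) [Field K] [CharZero K] [L.Structure K] [K ⊨ T]
    (O : ValuationSubring K) (hO : IsValuedFieldStructure ι K O)
    (A : Set K) (k p : ℕ) (hp : (p : ℕ∞) ≤ ℓ) (n : ℕ+)
    (S : Set (Unit ⊕ FamilyIndex k p → K)) (hS : A.Definable L S) (hlead : RespectsLead O n S) :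
    ∃ C : Set K, C.Finite ∧ C.Nonempty ∧ A.Definable₁ L C ∧ ∃ m : ℕ+,
      ∀ (t : FamilyIndex k p → K) (x y : K), t (.inr (.inl ())) ≠ 0 → t (.inr (.inl ())) ∈ O →
        (∀ c ∈ C, SameLead O (((m : ℕ) : K) * t (.inr (.inl ()))) (x - c) (y - c)) →
        (Sum.elim (fun _ => x) t ∈ S ↔ Sum.elim (fun _ => y) t ∈ S) := by
  by_contra! hcon
  let Q := {C : Set K // C.Finite ∧ C.Nonempty ∧ A.Definable₁ L C}
  -- Preparing the empty set yields some finite non-empty `A`-definable set.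
  have : Nonempty Q := by
    obtain ⟨m, C, hC, hprep⟩ := hmin K O hO 1 ⟨1, one_ne_zero, le_rfl⟩ A ∅ Set.finite_empty
      (by simp) ∅ ⟨0, Fin.elim0, fun i => i.elim0, ∅, Set.definable_empty, by simp⟩
    exact ⟨⟨C, hprep.1, hprep.2.1, hC⟩⟩
  have : IsDirectedOrder Q := ⟨fun C D => ⟨⟨C.1 ∪ D.1, C.2.1.union D.2.1, C.2.2.1.inl,
    C.2.2.2.union D.2.2.2⟩, Set.subset_union_left, Set.subset_union_right⟩⟩
  -- Factorials make the index monotone for divisibility: `|N!| ≤ |m|` as soon as `m ≤ N`.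
  have hfail : ∀ i : Q × ℕ, ∃ (t : FamilyIndex k p → K) (x y : K),
      t (.inr (.inl ())) ≠ 0 ∧ t (.inr (.inl ())) ∈ O ∧
      (∀ c ∈ i.1.1, SameLead O ((i.2.factorial : K) * t (.inr (.inl ()))) (x - c) (y - c)) ∧
      ¬ (Sum.elim (fun _ => x) t ∈ S ↔ Sum.elim (fun _ => y) t ∈ S) := by
    intro i
    obtain ⟨t, x, y, h1, h2, h3, h4⟩ := hcon i.1.1 i.1.2.1 i.1.2.2.1 i.1.2.2.2
      ⟨i.2.factorial, i.2.factorial_pos⟩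
    exact ⟨t, x, y, h1, h2, h3, by tauto⟩
  choose t x y hl0 hlO hxy hne using hfail
  have : IsDirectedOrder (Q × ℕ) := ⟨fun i j => by
    obtain ⟨C, h1, h2⟩ := exists_ge_ge i.1 j.1
    exact ⟨(C, max i.2 j.2), ⟨h1, le_max_left _ _⟩, h2, le_max_right _ _⟩⟩
  let U : Ultrafilter (Q × ℕ) := Ultrafilter.of atTop
  have hU : (U : Filter (Q × ℕ)) ≤ atTop := Ultrafilter.of_le atTop
  have hmod : ((U : Filter (Q × ℕ)).Product fun _ => K) ⊨ T :=
    ⟨fun φ hφ => (Ultraproduct.sentence_realize φ).2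
      (Eventually.of_forall fun _ => Theory.realize_sentence_of_mem T hφ)⟩
  obtain ⟨_, O', _, hO'⟩ := hT ((U : Filter (Q × ℕ)).Product fun _ => K)
  obtain ⟨π, hπ, hsurj, heq, hmem⟩ := exists_ringHom_ultrapower ι O hO U O' hO'
  have hlos : ∀ {β : Type (max u v w)} (φ : L.Formula β) (a : β → Q × ℕ → K),
      (φ.Realize fun b => π (a b)) ↔ ∀ᶠ i in U, φ.Realize fun b => a b i := by
    intro β φ a
    simp only [hπ]
    exact Ultraproduct.realize_formula_cast φ a
  let A' : Set ((U : Filter (Q × ℕ)).Product fun _ => K) := Set.range fun a : A => π fun _ => a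
  obtain ⟨ψ, hψ⟩ := Set.definable_iff_exists_formula_sum.1 hS
  let S' : Set (Unit ⊕ FamilyIndex k p → (U : Filter (Q × ℕ)).Product fun _ => K) :=
    {s | ψ.Realize (Sum.elim (fun a => π fun _ => a) s)}
  have hS' : A'.Definable L S' := by
    rw [Set.definable_iff_exists_formula_sum]
    refine ⟨ψ.relabel (Sum.map (fun a : A => (⟨π fun _ => a, a, rfl⟩ : A')) id), ?_⟩
    ext s
    simp only [S', Set.mem_ofPred_eq, Formula.realize_relabel]
    refine iff_of_eq (congrArg _ ?_)
    funext b
    rcases b with b | b <;> rfl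
  have hSS' : ∀ (a : Q × ℕ → K) (s : FamilyIndex k p → Q × ℕ → K),
      Sum.elim (fun _ => π a) (fun b => π (s b)) ∈ S' ↔
        ∀ᶠ i in U, Sum.elim (fun _ => a i) (fun b => s b i) ∈ S := by
    intro a s
    have h := hlos ψ (Sum.elim (fun c _ => c) (Sum.elim (fun _ => a) s))
    rw [hψ]
    refine Iff.trans (iff_of_eq ?_) (h.trans (eventually_congr (Eventually.of_forall fun i =>
      iff_of_eq ?_))) <;>
    · refine congrArg ψ.Realize (funext fun b => ?_)
      rcases b with b | b | b <;> rfl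
  have hlead' : RespectsLead O' n S' := by
    intro a s s' h1 h2 h3
    obtain ⟨a, rfl⟩ := hsurj a
    choose s hs using fun b => hsurj (s b)
    choose s' hs' using fun b => hsurj (s' b)
    obtain rfl := funext hs
    obtain rfl := funext hs'
    have hn : (((n : ℕ) : (U : Filter (Q × ℕ)).Product fun _ => K)) =
      π fun _ => ((n : ℕ) : K) := (map_natCast π n).symm
    simp only [hn, sameLead_iff_eventually hsurj heq hmem] at h1
    simp only [sameLead_iff_eventually hsurj heq hmem] at h3
    have h2a := (valuation_le_iff_eventually hsurj heq hmem _ _).1 h2.le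
    have h2b := (valuation_le_iff_eventually hsurj heq hmem _ _).1 h2.ge
    rw [hSS', hSS']
    refine eventually_congr ?_
    filter_upwards [eventually_all.2 h1, eventually_all.2 h3, h2a, h2b] with i h1 h3 h2a h2b
    exact hlead (a i) (fun b => s b i) (fun b => s' b i) h1 (h2a.antisymm h2b) h3
  let τ : FamilyIndex k p → (U : Filter (Q × ℕ)).Product fun _ => K := fun b => π fun i => t i b
  have hτ0 : τ (.inr (.inl ())) ≠ 0 := by
    rw [← map_zero π, Ne, heq]
    simp [hl0, U.neBot.ne]
  have hτO : τ (.inr (.inl ())) ∈ O' := (hmem _).2 (Eventually.of_forall hlO)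
  let r : Radius O' := ⟨O'.valuation (τ (.inr (.inl ()))), (Valuation.ne_zero_iff _).2 hτ0,
    (O'.valuation_le_one_iff _).2 hτO⟩
  obtain ⟨m, C', hC', hfin, ⟨c', hc'⟩, hprep⟩ := hmin _ O' hO' n r A' _ (Set.finite_range _)
    -- At most `p ≤ ℓ` leading terms in `RV_r` are used as parameters.
    (by
      rw [← Set.image_univ]
      refine (Set.encard_image_le _ _).trans ?_
      simpa using hp) _
    (definableOver_of_respectsLead O' hS' hlead' τ r rfl)
  obtain ⟨φ, hφ⟩ := Set.definable_iff_exists_formula_sum.1 hC'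
  -- Each parameter of `φ` is the class of a constant from `A`, so `φ` can be read in `K` over `A`.
  choose g hg using fun a : A' => a.2
  let C : Set K := {c | (φ.relabel (Sum.map g id)).Realize (Sum.elim (↑) fun _ : Fin 1 => c)}
  have hCdef : A.Definable₁ L C := by
    refine Set.definable_iff_exists_formula_sum.2 ⟨φ.relabel (Sum.map g id), ?_⟩
    ext s
    simp only [C, Set.mem_ofPred_eq]
    refine iff_of_eq (congrArg (fun s => Formula.Realize _ (Sum.elim _ s)) ?_)
    funext b
    rw [Subsingleton.elim 0 b]
  have hCC' : ∀ c : Q × ℕ → K, π c ∈ C' ↔ ∀ᶠ i in U, c i ∈ C := by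
    intro c
    have h := hlos φ (Sum.elim (fun a _ => g a) fun _ => c)
    have h0 := Set.ext_iff.1 hφ fun _ => π c
    simp only [Set.mem_ofPred_eq] at h0
    rw [h0]
    refine Iff.trans (iff_of_eq ?_) (h.trans (eventually_congr (Eventually.of_forall fun i => ?_)))
    · refine congrArg φ.Realize (funext fun b => ?_)
      rcases b with b | b
      · exact (hg b).symm
      · rfl
    · simp only [C, Set.mem_ofPred_eq, Formula.realize_relabel]
      refine iff_of_eq (congrArg φ.Realize (funext fun b => ?_))
      rcases b with b | b <;> rfl
  -- The diagonal embedding injects `C` into the finite set `C'`.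
  have hCfin : C.Finite := by
    refine Set.Finite.of_finite_image (f := fun c => π fun _ => c) (hfin.subset ?_) ?_
    · rintro _ ⟨c, hc, rfl⟩
      exact (hCC' _).2 (Eventually.of_forall fun _ => hc)
    · intro a _ b _ hab
      simpa using (heq _ _).1 hab
  have hCne : C.Nonempty := by
    obtain ⟨c, rfl⟩ := hsurj c'
    obtain ⟨i, hi⟩ := ((hCC' c).1 hc').exists
    exact ⟨c i, hi⟩
  -- The pair `(C, m)` is itself an index, so almost all failures lie above it.
  have hlarge : ∀ᶠ i in (U : Filter (Q × ℕ)),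
      ((⟨C, hCfin, hCne, hCdef⟩, m) : Q × ℕ) ≤ i := hU (eventually_ge_atTop _)
  have hiff := hprep (π x) (π y) fun c hc => by
    obtain ⟨c, rfl⟩ := hsurj c
    have hr : O'.valuation (π fun i => ((m : ℕ) : K) * t i (.inr (.inl ()))) =
        (absNat O' m * r).1 := by
      have : (fun i => ((m : ℕ) : K) * t i (.inr (.inl ()))) =
        ((m : ℕ) : Q × ℕ → K) * fun i => t i (.inr (.inl ())) := rfl
      rw [this, map_mul, map_natCast, map_mul]
      rfl
    rw [rv_eq_rv_iff_sameLead hr, ← map_sub, ← map_sub, sameLead_iff_eventually hsurj heq hmem]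
    filter_upwards [(hCC' c).1 hc, hlarge] with i hi hi'
    refine (hxy i (c i) (hi'.1 hi)).mono ?_
    rw [map_mul, map_mul]
    exact mul_le_mul_left (valuation_natCast_le_of_dvd (Nat.dvd_factorial m.pos hi'.2)) _
  simp only [Set.mem_ofPred_eq] at hiff
  rw [hSS', hSS'] at hiff
  have hnot : ∀ᶠ i in U, ¬ (Sum.elim (fun _ => x i) (fun b => t i b) ∈ S ↔
      Sum.elim (fun _ => y i) (fun b => t i b) ∈ S) := Eventually.of_forall hne
  by_cases hx : ∀ᶠ i in U, Sum.elim (fun _ => x i) (fun b => t i b) ∈ S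
  · obtain ⟨i, h1, h2, h3⟩ := (hx.and ((hiff.1 hx).and hnot)).exists
    exact h3 (iff_of_true h1 h2)
  · have hy := mt hiff.2 hx
    rw [← Ultrafilter.eventually_not] at hx hy
    obtain ⟨i, h1, h2, h3⟩ := (hx.and (hy.and hnot)).exists
    exact h3 (iff_of_false h1 h2)

end HMix

/-! ### From representatives to balls and fibres -/

theorem mainTheorem11 {L : FirstOrder.Language.{u, v}} (ι : HMix.Lval →ᴸ L) (T : L.Theory)
    (hT : HMix.IsValuedFieldTheory.{u, v, w} ι T)
    (ℓ : ℕ∞) (hmin : HMix.IsHMixMinimal.{u, v, w} ι T ℓ)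
    (K : Type (max u v w)) [Field K] [CharZero K] [L.Structure K] [K ⊨ T]
    (O : ValuationSubring K) (hO : HMix.IsValuedFieldStructure ι K O)
    (A : Set K) (k p : ℕ) (hp : (p : ℕ∞) ≤ ℓ) (n : ℕ+)
    (W : Set (K × (Fin k → HMix.RV O (HMix.absNat O n)) × HMix.RVTuples O p))
    (hW : HMix.DefinableFamily O L A W) :
    ∃ C : Set K, C.Finite ∧ C.Nonempty ∧ A.Definable₁ L C ∧
      ∃ m : ℕ+, ∀ (r : HMix.Radius O) (B : Set K),
        HMix.IsNextTo O (HMix.absNat O m * r) B C →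
          ∀ x ∈ B, ∀ y ∈ B, HMix.fiber O W x r = HMix.fiber O W y r := by
  obtain ⟨C, hfin, hne, hdef, m, hm⟩ := HMix.exists_prepared ι T hT ℓ hmin K O hO A k p hp n _ hW
    (HMix.respectsLead_preimage O W)
  refine ⟨C, hfin, hne, hdef, m, fun r B hB x hx y hy => ?_⟩
  obtain ⟨-, D, hD, rfl⟩ := hB
  obtain ⟨l, hl⟩ := O.valuation_surjective r.1
  have hl0 : l ≠ 0 := (Valuation.ne_zero_iff O.valuation).1 (hl ▸ r.2.1)
  have hlO : l ∈ O := (O.valuation_le_one_iff l).1 (hl ▸ r.2.2)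
  have hlead : ∀ c ∈ C, HMix.SameLead O (((m : ℕ) : K) * l) (x - c) (y - c) := by
    intro c hc
    obtain ⟨-, ξ, -, hξ⟩ := hD c hc
    have hxc := Set.mem_iInter₂.1 hx c hc
    have hyc := Set.mem_iInter₂.1 hy c hc
    rw [hξ] at hxc hyc
    refine (HMix.rv_eq_rv_iff_sameLead (r := HMix.absNat O m * r) ?_ _ _).1 (hxc.trans hyc.symm)
    rw [map_mul, hl]
    rfl
  ext ⟨ξ, η⟩
  choose a ha using fun i => HMix.rv_surjective O (HMix.absNat O n) (ξ i)
  choose b hb using fun j => HMix.rv_surjective O r (η j)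
  obtain rfl := funext ha
  obtain rfl := funext hb
  have h := hm (Sum.elim a (Sum.elim (fun _ => l) b)) x y hl0 hlO hlead
  simp only [Set.mem_ofPred_eq, Sum.elim_inl, Sum.elim_inr] at h
  -- The radius is determined by `|l|`, so the existential in the preimage of `W` collapses to `r`.
  have key : ∀ z : K, (∃ r' : HMix.Radius O, O.valuation l = r'.1 ∧
      (z, (fun i => HMix.rv O (HMix.absNat O n) (a i)),
        (⟨r', fun j => HMix.rv O r' (b j)⟩ : HMix.RVTuples O p)) ∈ W) ↔
      (z, (fun i => HMix.rv O (HMix.absNat O n) (a i)),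
        (⟨r, fun j => HMix.rv O r (b j)⟩ : HMix.RVTuples O p)) ∈ W := by
    intro z
    constructor
    · rintro ⟨r', hr', hz⟩
      obtain rfl : r' = r := Subtype.ext (hr'.symm.trans hl)
      exact hz
    · exact fun hz => ⟨r, hl, hz⟩
  rw [key, key] at h
  exact h
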